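/- For $n\ge 1$ consider the binomial channel with input $X\in[0,1]$ and output $Y\in\{0,\dots,n\}$, given by $P_{Y|X}(y|x)=\binom{n}{y}x^y(1-x)^{n-y}$, and let $$C(n)=\max_{P_X:\,X\in[0,1]} I(X;Y)$$ be its capacity in nats, the maximum being over all Borel probability laws $P_X$ on $[0,1]$ (logarithms are natural, and $I(X;Y)$ is the relative entropy of $P_{X,Y}$ with respect to $P_X\otimes P_Y$). Put $$L(n)=\log(\pi n)-\tfrac12\log\!\Big(2\pi e\big(\tfrac n8+\tfrac1{12}\big)\Big)+\frac{1}{\sqrt{\pi(n+\frac14)}}\log\!\Big(\frac1{16n^2}\Big)-\log 4-1 .$$ Then for every integer $n\ge1$ the maximum defining $C(n)$ is attained and finite, and $$C(n)\ \ge\ \max\{\log 2,\ L(n)\},$$ where $I(X;Y)\ge L(n)$ already holds when $X$ has the arcsine law, i.e. the $\mathrm{Beta}(\frac12,\frac12)$ distribution with density $\frac{1}{\pi\sqrt{x(1-x)}}$ on $(0,1)$; and $$C(n)\ \le\ \min\Big\{\log\!\Big(3+\Big\lfloor\frac{n-1}{2}\Big\rfloor\Big),\ \log(\pi(n+1))-\tfrac12\log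 n+\tfrac32+\frac{1}{2^{n+1}}\log n+\tfrac12\log\!\Big(\tfrac32\big(1+\tfrac1n\big)\Big)\Big\}.$$ Consequently $C(n)$ scales as $\frac12\log n$: as $n\to\infty$, $C(n)=\frac12\log n+O(1)$, and in particular $C(n)\sim\frac12\log n$. -/

import Mathlib

open MeasureTheory ProbabilityTheory InformationTheory
open scoped ENNReal unitInterval

/-- The binomial channel with `n` trials: for an input `x ∈ [0,1]` the output is distributed as
`Bin(n, x)`, a law on `ℕ` carried by `{0, …, n}`. -/
noncomputable def binomialChannel (n : ℕ) : Kernel I ℕ where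
  toFun x := ProbabilityTheory.binomial n x
  measurable' := by
    refine Measure.measurable_of_measurable_coe _ fun s _ => ?_
    have h : (fun x : I => ProbabilityTheory.binomial n x s) = fun x : I =>
        ∑ k ∈ Finset.Iic n,
          ENNReal.ofReal ((n.choose k) * (x : ℝ) ^ k * (1 - (x : ℝ)) ^ (n - k)) *
            s.indicator (1 : ℕ → ℝ≥0∞) k := by
      funext x
      rw [binomial_eq_sum_dirac]
      simp
    rw [h]
    fun_prop

/-- The transition probabilities of the binomial channel,
`P(y | x) = (n choose y) x ^ y (1 - x) ^ (n - y)`. -/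
theorem binomialChannel_apply_singleton (n : ℕ) (x : I) (y : ℕ) :
    binomialChannel n x {y} =
      ENNReal.ofReal ((n.choose y) * (x : ℝ) ^ y * (1 - (x : ℝ)) ^ (n - y)) :=
  binomial_singleton n y x

instance (n : ℕ) : IsMarkovKernel (binomialChannel n) :=
  ⟨fun x => inferInstanceAs (IsProbabilityMeasure (ProbabilityTheory.binomial n x))⟩

/-- The mutual information `I(X;Y)` (in nats) when `X` has law `P` and `Y` is the output of the
channel `κ` with input `X`: the relative entropy of the joint law of `(X, Y)` with respect to the
product of its marginals. -/
noncomputable def mutualInfo {α β : Type*} [MeasurableSpace α] [MeasurableSpace β]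
    (P : ProbabilityMeasure α) (κ : Kernel α β) : ℝ≥0∞ :=
  klDiv ((P : Measure α) ⊗ₘ κ) ((P : Measure α).prod (κ ∘ₘ (P : Measure α)))

/-- The capacity `C(n)` (in nats) of the binomial channel with `n` trials: the largest value of
`I(X;Y)` over all laws of the input `X ∈ [0,1]`. -/
noncomputable def capacity (n : ℕ) : ℝ≥0∞ :=
  ⨆ P : ProbabilityMeasure I, mutualInfo P (binomialChannel n)

/-- The arcsine law, i.e. the `Beta(1/2, 1/2)` distribution, as a law on `[0,1]`. -/
noncomputable def arcsineLaw : ProbabilityMeasure I :=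
  ⟨(betaMeasure (1 / 2) (1 / 2)).comap ((↑) : I → ℝ), by
    have hp : IsProbabilityMeasure (betaMeasure (1 / 2) (1 / 2)) :=
      isProbabilityMeasureBeta (by norm_num) (by norm_num)
    refine ⟨?_⟩
    rw [comap_subtype_coe_apply measurableSet_Icc, Set.image_univ, Subtype.range_coe]
    refine (prob_compl_eq_zero_iff measurableSet_Icc).1 ?_
    rw [betaMeasure, withDensity_apply _ measurableSet_Icc.compl]
    refine setLIntegral_eq_zero measurableSet_Icc.compl fun x hx => ?_
    rw [betaPDF_eq, if_neg, ENNReal.ofReal_zero]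
    · rfl
    · exact fun h => hx ⟨h.1.le, h.2.le⟩⟩

/-! Write `b_k(x)` for the likelihoods and `a_k` for the output probabilities. The mutual
information equals `∫ ∑ b_k log b_k - ∑ a_k log a_k` (`mutualInfo_binomialChannel`). Since `t log t`
is continuous, this is weakly continuous in the input law, and the laws on `[0,1]` form a compact
space; so the supremum is attained and finite.

Upper bounds: if `b_k ≤ w_k` pointwise, Gibbs' inequality gives `I ≤ log ∑ w_k` for every input
(`binomialInfo_le_log_sum`). With `w_0 = w_n = 1` and `1/2` in between (`bernstein_le_half`) this is
the floor bound. With Stirling's estimate `(1/√k + 1/√(n-k))/2` in between, the sum is at most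
`4√n`, which beats the second stated bound.

Lower bounds: the uniform law on the two endpoints gives exactly `log 2`. For the arcsine law the
two entropies are estimated separately. Conditionally on `x`, the binomial entropy is at most its
cross entropy against a discretised Gaussian (`neg_sum_bernstein_mul_log_le`); averaging uses only
`E[X(1-X)] = 1/8`. The output law is a product of two central binomial ratios, so `-log a_k` is at
least half of `log 2 + log (k+1) + log (n-k+1)`; Jensen's inequality and `E log X = E log (1-X) = -2
log 2` then bound the output entropy below by `log (n+1) - (3/2) log 2`. The result exceeds `L(n)`,
and with the bound `log (4√n)` it keeps `C(n)` within `2` of `(1/2) log n`. -/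

/-- For a density `g` of `μ` with respect to `ν`, the relative entropy is the `klFun`-divergence
computed with `g`. -/
lemma klDiv_withDensity_eq_lintegral_klFun {α : Type*} [MeasurableSpace α] (ν : Measure α)
    [IsFiniteMeasure ν] {g : α → ℝ≥0∞} (hg : Measurable g) [IsFiniteMeasure (ν.withDensity g)] :
    klDiv (ν.withDensity g) ν = ∫⁻ x, ENNReal.ofReal (klFun (g x).toReal) ∂ν := by
  rw [klDiv_eq_lintegral_klFun_of_ac (withDensity_absolutelyContinuous ν g)]
  refine lintegral_congr_ae ?_
  filter_upwards [Measure.rnDeriv_withDensity ν hg] with x hx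
  rw [hx]

/-! ### Mutual information of a channel with countable output alphabet -/

section CountableOutput

variable {α : Type*} [MeasurableSpace α]

lemma measurable_kernel_singleton_div (κ : Kernel α ℕ) (c : ℕ → ℝ≥0∞) :
    Measurable (fun z : α × ℕ => κ z.1 {z.2} / c z.2) := by
  refine measurable_from_prod_countable_left fun k => ?_
  have h : Measurable fun x => κ x {k} := κ.measurable_coe (measurableSet_singleton k)
  exact h.div (measurable_const (a := c k))

/-- The joint law of input and output of a channel with countable output alphabet has density
`κ x {k} / (κ ∘ₘ P) {k}` with respect to the product of the marginals. -/
lemma compProd_eq_prod_withDensity (P : Measure α) [IsProbabilityMeasure P] (κ : Kernel α ℕ)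
    [IsMarkovKernel κ] :
    P ⊗ₘ κ = (P.prod (κ ∘ₘ P)).withDensity (fun z => κ z.1 {z.2} / (κ ∘ₘ P) {z.2}) := by
  have hmeas : Measurable (fun z : α × ℕ => κ z.1 {z.2} / (κ ∘ₘ P) {z.2}) :=
    measurable_kernel_singleton_div κ fun k => (κ ∘ₘ P) {k}
  refine Measure.ext_of_lintegral _ fun f hf => ?_
  rw [lintegral_withDensity_eq_lintegral_mul _ hmeas hf, Measure.lintegral_compProd hf,
    lintegral_prod _ (hmeas.mul hf).aemeasurable]
  -- Where the output mass vanishes the quotient is no true density, but there the likelihood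
  -- vanishes for almost every input, so both sides are zero.
  have hzero : ∀ᵐ x ∂P, ∀ k, (κ ∘ₘ P) {k} = 0 → κ x {k} = 0 := by
    rw [ae_all_iff]
    intro k
    by_cases h : (κ ∘ₘ P) {k} = 0
    · have h' := h
      rw [Measure.bind_apply (measurableSet_singleton k) κ.aemeasurable,
        lintegral_eq_zero_iff (κ.measurable_coe (measurableSet_singleton k))] at h'
      filter_upwards [h'] with x hx _ using hx
    · exact ae_of_all _ fun x h2 => absurd h2 h
  refine lintegral_congr_ae ?_
  filter_upwards [hzero] with x hx
  rw [lintegral_countable', lintegral_countable']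
  refine tsum_congr fun k => ?_
  simp only [Pi.mul_apply]
  by_cases h : (κ ∘ₘ P) {k} = 0
  · simp [h, hx k h]
  · rw [mul_right_comm, ENNReal.div_mul_cancel h (measure_ne_top _ _), mul_comm]

lemma mutualInfo_eq_lintegral_tsum (P : ProbabilityMeasure α) (κ : Kernel α ℕ)
    [IsMarkovKernel κ] :
    mutualInfo P κ = ∫⁻ x, ∑' k, ENNReal.ofReal
      (klFun (κ x {k} / (κ ∘ₘ (P : Measure α)) {k}).toReal) * (κ ∘ₘ (P : Measure α)) {k}
      ∂(P : Measure α) := by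
  have hmeas : Measurable
      (fun z : α × ℕ => κ z.1 {z.2} / (κ ∘ₘ (P : Measure α)) {z.2}) :=
    measurable_kernel_singleton_div κ fun k => (κ ∘ₘ (P : Measure α)) {k}
  have hmeas' : Measurable (fun z : α × ℕ => ENNReal.ofReal
      (klFun (κ z.1 {z.2} / (κ ∘ₘ (P : Measure α)) {z.2}).toReal)) :=
    (measurable_klFun.comp hmeas.ennreal_toReal).ennreal_ofReal
  have heq := compProd_eq_prod_withDensity (P : Measure α) κ
  have : IsFiniteMeasure (((P : Measure α).prod (κ ∘ₘ (P : Measure α))).withDensity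
      (fun z => κ z.1 {z.2} / (κ ∘ₘ (P : Measure α)) {z.2})) := heq ▸ inferInstance
  rw [mutualInfo, heq, klDiv_withDensity_eq_lintegral_klFun _ hmeas,
    lintegral_prod _ hmeas'.aemeasurable]
  refine lintegral_congr fun x => ?_
  rw [lintegral_countable']

end CountableOutput

/-! ### Entropy formula for the binomial channel and attainment of the capacity -/

lemma sum_bernstein (n : ℕ) (x : I) : ∑ k ∈ Finset.range (n + 1), bernstein n k x = 1 := by
  rw [Finset.sum_range]; exact bernstein.probability n x

lemma bernstein_eq_zero_of_lt {n k : ℕ} (h : n < k) (x : I) : bernstein n k x = 0 := by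
  simp [bernstein_apply, Nat.choose_eq_zero_of_lt h]

lemma bernstein_le_one (n k : ℕ) (x : I) : bernstein n k x ≤ 1 := by
  rcases lt_or_ge n k with h | h
  · rw [bernstein_eq_zero_of_lt h]; exact zero_le_one
  · rw [← sum_bernstein n x]
    exact Finset.single_le_sum (f := fun k => bernstein n k x) (fun _ _ => bernstein_nonneg)
      (Finset.mem_range.2 (by omega))

lemma integrable_of_continuous (P : Measure I) [IsFiniteMeasure P] {f : I → ℝ}
    (hf : Continuous f) : Integrable f P :=
  hf.integrable_of_hasCompactSupport (HasCompactSupport.of_compactSpace f)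

/-- The probability of the output `k` of the binomial channel with input law `P`. -/
noncomputable def outputProb (n : ℕ) (P : Measure I) (k : ℕ) : ℝ := ∫ x, bernstein n k x ∂P

/-- The mutual information of the binomial channel, written as output entropy minus conditional
output entropy. -/
noncomputable def binomialInfo (n : ℕ) (P : Measure I) : ℝ :=
  (∫ x, ∑ k ∈ Finset.range (n + 1), bernstein n k x * Real.log (bernstein n k x) ∂P) -
    ∑ k ∈ Finset.range (n + 1), outputProb n P k * Real.log (outputProb n P k)

lemma outputProb_nonneg (n : ℕ) (P : Measure I) (k : ℕ) : 0 ≤ outputProb n P k :=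
  integral_nonneg fun _ => bernstein_nonneg

lemma sum_outputProb (n : ℕ) (P : Measure I) [IsProbabilityMeasure P] :
    ∑ k ∈ Finset.range (n + 1), outputProb n P k = 1 := by
  simp only [outputProb]
  rw [← integral_finsetSum _ fun k _ => integrable_of_continuous P (bernstein n k).continuous]
  simp [sum_bernstein]

lemma continuous_bernstein_mul_log (n k : ℕ) :
    Continuous fun x : I => bernstein n k x * Real.log (bernstein n k x) :=
  Real.continuous_mul_log.comp (bernstein n k).continuous

lemma binomialChannel_comp_singleton (n : ℕ) (P : Measure I) [IsProbabilityMeasure P] (k : ℕ) :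
    (binomialChannel n ∘ₘ P) {k} = ENNReal.ofReal (outputProb n P k) := by
  rw [Measure.bind_apply (measurableSet_singleton k) (Kernel.aemeasurable _), outputProb,
    ofReal_integral_eq_lintegral_ofReal (integrable_of_continuous P (bernstein n k).continuous)
      (ae_of_all _ fun _ => bernstein_nonneg)]
  refine lintegral_congr fun x => ?_
  rw [binomialChannel_apply_singleton, bernstein_apply]

lemma mul_klFun_div {p a : ℝ} (hp : 0 ≤ p) (ha : 0 < a) :
    klFun (p / a) * a = p * Real.log p - p * Real.log a + a - p := by
  rw [klFun_apply]
  rcases hp.eq_or_lt with rfl | hp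
  · simp
  · rw [Real.log_div hp.ne' ha.ne']; field_simp

/-- The integrand `F` of the `klFun` formula is continuous and nonnegative. Expanding `klFun` gives
the two entropy sums, and the correction terms `a_k - b_k` integrate to zero. -/
lemma mutualInfo_binomialChannel (n : ℕ) (P : ProbabilityMeasure I) :
    0 ≤ binomialInfo n P ∧
      mutualInfo P (binomialChannel n) = ENNReal.ofReal (binomialInfo n P) := by
  set a := outputProb n (P : Measure I) with ha
  have ha0 : ∀ k, 0 ≤ a k := outputProb_nonneg n P
  let F : I → ℝ := fun x => ∑ k ∈ Finset.range (n + 1), klFun (bernstein n k x / a k) * a k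
  have hFnn : ∀ x, 0 ≤ F x := fun x => Finset.sum_nonneg fun k _ =>
    mul_nonneg (klFun_nonneg (div_nonneg bernstein_nonneg (ha0 k))) (ha0 k)
  have hFcont : Continuous F := continuous_finsetSum _ fun k _ =>
    (continuous_klFun.comp ((bernstein n k).continuous.div_const _)).mul continuous_const
  have hFint : ∫ x, F x ∂(P : Measure I) = binomialInfo n P := by
    have hc1 : ∀ k ∈ Finset.range (n + 1), Integrable
        (fun x => bernstein n k x * Real.log (bernstein n k x)) (P : Measure I) := fun k _ =>
      integrable_of_continuous _ (continuous_bernstein_mul_log n k)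
    have hb : ∀ k, Integrable (fun x => bernstein n k x) (P : Measure I) := fun k =>
      integrable_of_continuous _ (bernstein n k).continuous
    rw [binomialInfo, integral_finsetSum _ hc1, ← Finset.sum_sub_distrib]
    simp only [F]
    rw [integral_finsetSum (f := fun k x => klFun (bernstein n k x / a k) * a k) _
      fun k _ => integrable_of_continuous _ ((continuous_klFun.comp ((bernstein n k).continuous.div_const _)).mul
        continuous_const)]
    refine Finset.sum_congr rfl fun k hk => ?_
    -- If `a_k = 0`, then `b_k = 0` almost everywhere, so the conventions `p / 0 = 0` and `log 0 =
    -- 0` are harmless.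
    rcases (ha0 k).eq_or_lt with h | h
    · have h0 : (fun x => bernstein n k x) =ᵐ[(P : Measure I)] 0 :=
        (integral_eq_zero_iff_of_nonneg (fun x => bernstein_nonneg) (hb k)).1 h.symm
      have : ∫ x, bernstein n k x * Real.log (bernstein n k x) ∂(P : Measure I) = 0 := by
        refine integral_eq_zero_of_ae ?_
        filter_upwards [h0] with x hx
        simp only [Pi.zero_apply] at hx ⊢
        simp [hx]
      rw [this, ← ha, ← h]; simp
    · simp_rw [mul_klFun_div (bernstein_nonneg (n := n) (ν := k)) h]
      rw [integral_sub, integral_add, integral_sub, integral_mul_const, integral_const]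
      · simp only [probReal_univ, one_smul, ← ha]
        have : ∫ x, bernstein n k x ∂(P : Measure I) = a k := rfl
        rw [this]; ring
      · exact hc1 k hk
      · exact (hb k).mul_const _
      · exact (hc1 k hk).sub ((hb k).mul_const _)
      · exact integrable_const _
      · exact ((hc1 k hk).sub ((hb k).mul_const _)).add (integrable_const _)
      · exact hb k
  refine ⟨hFint ▸ integral_nonneg hFnn, ?_⟩
  rw [mutualInfo_eq_lintegral_tsum, ← hFint, ofReal_integral_eq_lintegral_ofReal
    (integrable_of_continuous _ hFcont) (ae_of_all _ hFnn)]
  refine lintegral_congr fun x => ?_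
  -- Outputs above `n` have mass zero, so the series is a finite sum.
  rw [tsum_eq_sum (s := Finset.range (n + 1)), ENNReal.ofReal_sum_of_nonneg]
  · refine Finset.sum_congr rfl fun k _ => ?_
    rw [binomialChannel_comp_singleton, binomialChannel_apply_singleton, ← bernstein_apply,
      ENNReal.toReal_div, ENNReal.toReal_ofReal bernstein_nonneg, ENNReal.toReal_ofReal (ha0 k),
      ← ENNReal.ofReal_mul (klFun_nonneg (div_nonneg bernstein_nonneg (ha0 k)))]
  · exact fun k _ =>
      mul_nonneg (klFun_nonneg (div_nonneg bernstein_nonneg (ha0 k))) (ha0 k)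
  · intro k hk
    rw [Finset.mem_range, not_lt] at hk
    rw [binomialChannel_comp_singleton, outputProb]
    simp [bernstein_eq_zero_of_lt (show n < k by omega)]

lemma toReal_mutualInfo_binomialChannel (n : ℕ) (P : ProbabilityMeasure I) :
    (mutualInfo P (binomialChannel n)).toReal = binomialInfo n P := by
  rw [(mutualInfo_binomialChannel n P).2,
    ENNReal.toReal_ofReal (mutualInfo_binomialChannel n P).1]

lemma continuous_integral_of_continuous {f : I → ℝ} (hf : Continuous f) :
    Continuous fun P : ProbabilityMeasure I => ∫ x, f x ∂(P : Measure I) :=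
  ProbabilityMeasure.continuous_integral_boundedContinuousFunction
    (BoundedContinuousFunction.mkOfCompact ⟨f, hf⟩)

/-- Weak convergence suffices because every integrand is continuous on `[0,1]`, including `b log b`
at the zeros of `b`. -/
lemma continuous_binomialInfo (n : ℕ) :
    Continuous fun P : ProbabilityMeasure I => binomialInfo n (P : Measure I) := by
  refine (continuous_integral_of_continuous
    (continuous_finsetSum _ fun k _ => continuous_bernstein_mul_log n k)).sub
    (continuous_finsetSum _ fun k _ => ?_)
  exact Real.continuous_mul_log.comp (continuous_integral_of_continuous (bernstein n k).continuous)

/-- The capacity of the binomial channel is attained. -/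
lemma exists_mutualInfo_eq_capacity (n : ℕ) :
    ∃ P : ProbabilityMeasure I, mutualInfo P (binomialChannel n) = capacity n := by
  have : Nonempty (ProbabilityMeasure I) := ⟨arcsineLaw⟩
  obtain ⟨P, -, hP⟩ := isCompact_univ.exists_isMaxOn Set.univ_nonempty
    (continuous_binomialInfo n).continuousOn
  refine ⟨P, le_antisymm (le_iSup (fun P => mutualInfo P (binomialChannel n)) P)
    (iSup_le fun Q => ?_)⟩
  rw [(mutualInfo_binomialChannel n P).2, (mutualInfo_binomialChannel n Q).2]
  exact ENNReal.ofReal_le_ofReal (hP (Set.mem_univ Q))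

/-! ### Upper bounds from pointwise bounds on the likelihoods -/

/-- If the likelihoods of the output `k` are bounded by `w k`, then the mutual information is at
most `log (∑ k, w k)`. -/
lemma binomialInfo_le_log_sum (n : ℕ) (P : Measure I) [IsProbabilityMeasure P] {w : ℕ → ℝ}
    (hw : ∀ k ≤ n, 0 < w k) (h : ∀ k ≤ n, ∀ x, bernstein n k x ≤ w k) :
    binomialInfo n P ≤ Real.log (∑ k ∈ Finset.range (n + 1), w k) := by
  set W := ∑ k ∈ Finset.range (n + 1), w k with hW
  have hW0 : 0 < W := Finset.sum_pos (fun k hk => hw k (by simpa [Nat.lt_succ_iff] using hk))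
    ⟨0, by simp⟩
  have h1 : ∫ x, ∑ k ∈ Finset.range (n + 1), bernstein n k x * Real.log (bernstein n k x) ∂P
      ≤ ∑ k ∈ Finset.range (n + 1), outputProb n P k * Real.log (w k) := by
    rw [integral_finsetSum _ fun k _ =>
      integrable_of_continuous P (continuous_bernstein_mul_log n k)]
    refine Finset.sum_le_sum fun k hk => ?_
    rw [outputProb, ← integral_mul_const]
    refine integral_mono (integrable_of_continuous P (continuous_bernstein_mul_log n k))
      ((integrable_of_continuous P (bernstein n k).continuous).mul_const _) fun x => ?_
    have hk' : k ≤ n := by simpa [Nat.lt_succ_iff] using hk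
    have h0 : 0 ≤ bernstein n k x := bernstein_nonneg
    rcases h0.eq_or_lt with h0 | h0
    · simp [← h0]
    · exact mul_le_mul_of_nonneg_left (Real.log_le_log h0 (h k hk' x)) h0.le
  -- Gibbs' inequality against the normalised weights `w_k / W`, from `log t ≤ t - 1`; the bracketed
  -- terms sum to zero.
  have h2 : ∀ k ∈ Finset.range (n + 1), outputProb n P k * Real.log (w k) -
      outputProb n P k * Real.log (outputProb n P k) ≤
      outputProb n P k * Real.log W + (w k / W - outputProb n P k) := by
    intro k hk
    have hwk : 0 < w k := hw k (by simpa [Nat.lt_succ_iff] using hk)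
    rcases (outputProb_nonneg n P k).eq_or_lt with h0 | h0
    · rw [← h0]; simp; positivity
    · have := Real.log_le_sub_one_of_pos (show 0 < w k / W / outputProb n P k by positivity)
      rw [Real.log_div (by positivity) h0.ne', Real.log_div hwk.ne' hW0.ne'] at this
      have := mul_le_mul_of_nonneg_left this h0.le
      have h3 : outputProb n P k * (w k / W / outputProb n P k - 1) =
        w k / W - outputProb n P k := by field_simp
      rw [h3] at this
      linarith
  have h3 := Finset.sum_le_sum h2
  rw [Finset.sum_sub_distrib, Finset.sum_add_distrib, Finset.sum_sub_distrib, ← Finset.sum_mul,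
    ← Finset.sum_div, sum_outputProb, ← hW, div_self hW0.ne'] at h3
  rw [binomialInfo]
  linarith

lemma exists_binomialInfo_eq_capacity (n : ℕ) :
    ∃ P : ProbabilityMeasure I, (capacity n).toReal = binomialInfo n P := by
  obtain ⟨P, hP⟩ := exists_mutualInfo_eq_capacity n
  exact ⟨P, by rw [← hP, toReal_mutualInfo_binomialChannel]⟩

lemma capacity_ne_top (n : ℕ) : capacity n ≠ ∞ := by
  obtain ⟨P, hP⟩ := exists_mutualInfo_eq_capacity n
  rw [← hP, (mutualInfo_binomialChannel n P).2]
  exact ENNReal.ofReal_ne_top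

lemma binomialInfo_le_toReal_capacity (n : ℕ) (P : ProbabilityMeasure I) :
    binomialInfo n P ≤ (capacity n).toReal := by
  rw [← toReal_mutualInfo_binomialChannel]
  exact ENNReal.toReal_mono (capacity_ne_top n)
    (le_iSup (fun P => mutualInfo P (binomialChannel n)) P)

lemma toReal_capacity_le_log_sum (n : ℕ) {w : ℕ → ℝ} (hw : ∀ k ≤ n, 0 < w k)
    (h : ∀ k ≤ n, ∀ x, bernstein n k x ≤ w k) :
    (capacity n).toReal ≤ Real.log (∑ k ∈ Finset.range (n + 1), w k) := by
  obtain ⟨P, hP⟩ := exists_binomialInfo_eq_capacity n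
  exact hP ▸ binomialInfo_le_log_sum n P hw h

/-- The ratio of the square to the product of its neighbours is `(j+2)(m+2) / ((j+1)(m+1))`, and
each factor contributes at most `2`. -/
lemma choose_succ_sq_le (j m : ℕ) :
    ((j + m + 2).choose (j + 1)) ^ 2 ≤
      4 * ((j + m + 2).choose j * (j + m + 2).choose (j + 2)) := by
  have h1 := Nat.choose_succ_right_eq (j + m + 2) j
  have h2 := Nat.choose_succ_right_eq (j + m + 2) (j + 1)
  rw [show j + m + 2 - j = m + 2 by omega] at h1
  rw [show j + m + 2 - (j + 1) = m + 1 by omega, show j + 1 + 1 = j + 2 by omega] at h2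
  set a := (j + m + 2).choose j
  set b := (j + m + 2).choose (j + 1)
  set c := (j + m + 2).choose (j + 2)
  refine Nat.le_of_mul_le_mul_right (c := (j + 1) * (m + 1)) ?_ (by positivity)
  calc b ^ 2 * ((j + 1) * (m + 1)) = (b * (j + 1)) * (b * (m + 1)) := by ring
    _ = (a * c) * ((m + 2) * (j + 2)) := by rw [h1, ← h2]; ring
    _ ≤ (a * c) * (4 * ((j + 1) * (m + 1))) := Nat.mul_le_mul_left _ (by nlinarith)
    _ = 4 * (a * c) * ((j + 1) * (m + 1)) := by ring

/-- The interior probabilities of a binomial law are at most `1 / 2`. -/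
lemma bernstein_le_half {n k : ℕ} (hk : 0 < k) (hkn : k < n) (x : I) :
    bernstein n k x ≤ 1 / 2 := by
  obtain ⟨j, rfl⟩ : ∃ j, k = j + 1 := ⟨k - 1, by omega⟩
  obtain ⟨m, rfl⟩ : ∃ m, n = j + m + 2 := ⟨n - j - 2, by omega⟩
  have ha : 0 ≤ bernstein (j + m + 2) j x := bernstein_nonneg
  have hb : 0 ≤ bernstein (j + m + 2) (j + 1) x := bernstein_nonneg
  have hc : 0 ≤ bernstein (j + m + 2) (j + 2) x := bernstein_nonneg
  have hsum : bernstein (j + m + 2) j x + bernstein (j + m + 2) (j + 1) x +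
      bernstein (j + m + 2) (j + 2) x ≤ 1 := by
    rw [← sum_bernstein (j + m + 2) x]
    have hs : ({j, j + 1, j + 2} : Finset ℕ) ⊆ Finset.range (j + m + 2 + 1) := by
      intro i hi
      simp only [Finset.mem_insert, Finset.mem_singleton] at hi
      simp only [Finset.mem_range]
      omega
    refine le_trans (le_of_eq ?_) (Finset.sum_le_sum_of_subset_of_nonneg hs
      fun i _ _ => bernstein_nonneg)
    rw [Finset.sum_insert (by simp), Finset.sum_insert (by simp), Finset.sum_singleton, add_assoc]
  have hsq : bernstein (j + m + 2) (j + 1) x ^ 2 ≤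
      4 * (bernstein (j + m + 2) j x * bernstein (j + m + 2) (j + 2) x) := by
    simp only [bernstein_apply]
    rw [show j + m + 2 - j = m + 2 by omega, show j + m + 2 - (j + 1) = m + 1 by omega,
      show j + m + 2 - (j + 2) = m by omega]
    have h : (((j + m + 2).choose (j + 1) : ℝ)) ^ 2 ≤
        4 * (((j + m + 2).choose j : ℝ) * ((j + m + 2).choose (j + 2) : ℝ)) := by
      exact_mod_cast choose_succ_sq_le j m
    have := mul_le_mul_of_nonneg_right h
      (sq_nonneg ((x : ℝ) ^ (j + 1) * (1 - (x : ℝ)) ^ (m + 1)))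
    calc _ = _ := by ring
      _ ≤ _ := this
      _ = _ := by ring
  -- AM-GM turns `b² ≤ 4ac` into `b ≤ a + c`; with `a + b + c ≤ 1` this forces `2b ≤ 1`.
  have : bernstein (j + m + 2) (j + 1) x ≤
      bernstein (j + m + 2) j x + bernstein (j + m + 2) (j + 2) x := by
    refine le_of_sq_le_sq ?_ (by positivity)
    nlinarith [sq_nonneg (bernstein (j + m + 2) j x - bernstein (j + m + 2) (j + 2) x)]
  linarith

lemma toReal_capacity_le_log_floor (n : ℕ) :
    (capacity n).toReal ≤ Real.log (3 + (⌊((n : ℝ) - 1) / 2⌋ : ℝ)) := by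
  let w : ℕ → ℝ := fun k => 1 / 2 + (if k = 0 then 1 / 2 else 0) + (if k = n then 1 / 2 else 0)
  have hw : ∀ k, 0 < w k := fun k => by
    simp only [w]; split_ifs <;> norm_num
  refine (toReal_capacity_le_log_sum n (fun k _ => hw k) fun k hk x => ?_).trans ?_
  · by_cases h0 : k = 0
    · refine (bernstein_le_one n k x).trans ?_
      simp only [w, h0, if_true]; split_ifs <;> norm_num
    by_cases h1 : k = n
    · refine (bernstein_le_one n k x).trans ?_
      simp only [w, h1, if_true]; split_ifs <;> norm_num
    · simpa [w, h0, h1] using bernstein_le_half (by omega) (by omega) x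
  · refine Real.log_le_log (Finset.sum_pos (fun k _ => hw k) ⟨0, by simp⟩) ?_
    -- The weights sum to `2 + (n-1)/2`; rounding up to an integer costs less than one.
    have hf := Int.lt_floor_add_one (((n : ℝ) - 1) / 2)
    simp only [w, Finset.sum_add_distrib, Finset.sum_ite_eq']
    simp
    linarith

/-! ### Stirling bounds and capacity at most `log (4 √n)` -/

lemma factorial_le_stirling {n : ℕ} (hn : n ≠ 0) :
    (n.factorial : ℝ) ≤ Real.exp 1 * √n * (n / Real.exp 1) ^ n := by
  obtain ⟨m, rfl⟩ := Nat.exists_eq_succ_of_ne_zero hn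
  -- The Stirling sequence decreases from its value `e / √2` at `1`.
  have h := Stirling.stirlingSeq'_antitone (Nat.zero_le m)
  simp only [Function.comp_apply, Nat.succ_eq_add_one, zero_add, Stirling.stirlingSeq_one] at h
  rw [Stirling.stirlingSeq, div_le_iff₀ (by positivity)] at h
  refine h.trans (le_of_eq ?_)
  rw [Real.sqrt_mul (by norm_num)]
  have : √(2 : ℝ) ≠ 0 := by positivity
  field_simp

/-- The likelihood `x ^ k (1 - x) ^ m` is largest at `x = k / (k + m)`. -/
lemma pow_mul_one_sub_pow_le {k m : ℕ} (hk : k ≠ 0) (hm : m ≠ 0) (x : I) :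
    ((k + m : ℕ) : ℝ) ^ (k + m) * ((x : ℝ) ^ k * (1 - (x : ℝ)) ^ m) ≤ (k : ℝ) ^ k * (m : ℝ) ^ m := by
  -- This is `t / j ≤ exp (t / j - 1)` raised to the power `j`. For `t = (k+m)x` and `t =
  -- (k+m)(1-x)` the two exponents cancel, so no calculus is needed.
  have key : ∀ (j : ℕ) (t : ℝ), j ≠ 0 → 0 ≤ t → t ^ j ≤ (j : ℝ) ^ j * Real.exp (t - j) := by
    intro j t hj ht
    have hj' : (0 : ℝ) < j := by positivity
    have h1 : t ≤ j * Real.exp (t / j - 1) := by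
      have := Real.add_one_le_exp (t / j - 1)
      calc t = j * (t / j - 1 + 1) := by field_simp; ring
        _ ≤ _ := by gcongr
    calc t ^ j ≤ (j * Real.exp (t / j - 1)) ^ j := pow_le_pow_left₀ ht h1 j
      _ = _ := by
        rw [mul_pow, ← Real.exp_nat_mul]
        congr 2
        field_simp
  have hx0 : (0 : ℝ) ≤ x := x.2.1
  have hx1 : (0 : ℝ) ≤ 1 - x := sub_nonneg.2 x.2.2
  have h1 := key k ((k + m : ℕ) * x) hk (by positivity)
  have h2 := key m ((k + m : ℕ) * (1 - x)) hm (by positivity)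
  have h3 := mul_le_mul h1 h2 (by positivity) (by positivity)
  calc _ = (((k + m : ℕ) : ℝ) * x) ^ k * (((k + m : ℕ) : ℝ) * (1 - x)) ^ m := by
        rw [mul_pow, mul_pow, pow_add]; ring
    _ ≤ _ := h3
    _ = (k : ℝ) ^ k * (m : ℝ) ^ m *
        Real.exp (((k + m : ℕ) : ℝ) * x - k + (((k + m : ℕ) : ℝ) * (1 - x) - m)) := by
        rw [Real.exp_add]; ring
    _ = _ := by
        rw [show ((k + m : ℕ) : ℝ) * (x : ℝ) - k + (((k + m : ℕ) : ℝ) * (1 - x) - m) = 0 by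
          push_cast; ring, Real.exp_zero, mul_one]

/-- At the maximising `x` the powers cancel against those in Stirling's formula, leaving at most `(e
/ 2π) √(k+m) / (√k √m)`. Then `e ≤ π` and `√(k+m) ≤ √k + √m` give a form that is easy to sum. -/
lemma bernstein_le_of_add_eq {n k m : ℕ} (hk : k ≠ 0) (hm : m ≠ 0) (h : k + m = n) (x : I) :
    bernstein n k x ≤ 1 / 2 * (1 / √k + 1 / √m) := by
  subst h
  have hx0 : (0 : ℝ) ≤ x := x.2.1
  have hx1 : (0 : ℝ) ≤ 1 - x := sub_nonneg.2 x.2.2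
  have hk0 : (0 : ℝ) < k := by positivity
  have hm0 : (0 : ℝ) < m := by positivity
  rw [bernstein_apply, show k + m - k = m by omega]
  set T : ℝ := (k / Real.exp 1) ^ k * (m / Real.exp 1) ^ m with hT
  have hT0 : 0 < T := by positivity
  have hC : (((k + m).choose k : ℕ) : ℝ) * k.factorial * m.factorial = (k + m).factorial := by
    rw [Nat.choose_symm_add]
    exact_mod_cast Nat.add_choose_mul_factorial_mul_factorial k m
  have hup : ((k + m).factorial : ℝ) * ((x : ℝ) ^ k * (1 - (x : ℝ)) ^ m) ≤
      Real.exp 1 * √((k + m : ℕ) : ℝ) * T := by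
    refine (mul_le_mul_of_nonneg_right (factorial_le_stirling (by omega))
      (by positivity)).trans ?_
    have := pow_mul_one_sub_pow_le hk hm x
    calc _ = Real.exp 1 * √((k + m : ℕ) : ℝ) * ((((k + m : ℕ) : ℝ) ^ (k + m) *
          ((x : ℝ) ^ k * (1 - (x : ℝ)) ^ m)) / Real.exp 1 ^ (k + m)) := by
          rw [div_pow]; ring
      _ ≤ Real.exp 1 * √((k + m : ℕ) : ℝ) * (((k : ℝ) ^ k * (m : ℝ) ^ m) /
          Real.exp 1 ^ (k + m)) := by gcongr
      _ = _ := by rw [hT, div_pow, div_pow, pow_add]; field_simp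
  have hlow : 2 * Real.pi * (√k * √m) * T ≤ (k.factorial : ℝ) * m.factorial := by
    have h1 := mul_le_mul (Stirling.le_factorial_stirling k) (Stirling.le_factorial_stirling m)
      (by positivity) (by positivity)
    refine le_trans (le_of_eq ?_) h1
    rw [Real.sqrt_mul (by positivity) (k : ℝ), Real.sqrt_mul (by positivity) (m : ℝ)]
    have : √(2 * Real.pi) * √(2 * Real.pi) = 2 * Real.pi := Real.mul_self_sqrt (by positivity)
    calc _ = (√(2 * Real.pi) * √(2 * Real.pi)) * (√k * √m) * T := by rw [this]
      _ = _ := by rw [hT]; ring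
  have hsqrt : √((k + m : ℕ) : ℝ) ≤ √k + √m := by
    push_cast
    refine Real.sqrt_le_iff.2 ⟨by positivity, ?_⟩
    rw [add_sq, Real.sq_sqrt hk0.le, Real.sq_sqrt hm0.le]
    have : 0 ≤ 2 * √(k : ℝ) * √(m : ℝ) := by positivity
    linarith
  have hexp : Real.exp 1 ≤ Real.pi :=
    (Real.exp_one_lt_d9.trans (lt_trans (by norm_num) Real.pi_gt_three)).le
  set B : ℝ := ((k + m).choose k : ℝ) * (x : ℝ) ^ k * (1 - (x : ℝ)) ^ m with hB
  have hB0 : 0 ≤ B := by positivity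
  have hmain : B * (2 * Real.pi * (√k * √m) * T) ≤ Real.pi * (√k + √m) * T := by
    calc B * (2 * Real.pi * (√k * √m) * T) ≤ B * ((k.factorial : ℝ) * m.factorial) := by gcongr
      _ = ((k + m).factorial : ℝ) * ((x : ℝ) ^ k * (1 - (x : ℝ)) ^ m) := by rw [← hC, hB]; ring
      _ ≤ _ := hup
      _ ≤ _ := by gcongr
  have hk1 : 0 < √(k : ℝ) := by positivity
  have hm1 : 0 < √(m : ℝ) := by positivity
  have : 1 / 2 * (1 / √(k : ℝ) + 1 / √m) =
      (Real.pi * (√k + √m) * T) / (2 * Real.pi * (√k * √m) * T) := by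
    field_simp; ring
  rw [this, le_div_iff₀ (by positivity)]
  exact hmain

lemma sum_one_div_sqrt_le (n : ℕ) : ∑ k ∈ Finset.range (n + 1), 1 / √(k : ℝ) ≤ 2 * √n := by
  induction n with
  | zero => simp
  | succ n ih =>
    rw [Finset.sum_range_succ]
    have h1 : 0 < √((n + 1 : ℕ) : ℝ) := by positivity
    have h0 := Real.sqrt_nonneg (n : ℝ)
    have hs1 : √((n + 1 : ℕ) : ℝ) ^ 2 = n + 1 := by rw [Real.sq_sqrt (by positivity)]; push_cast; ring
    have hs0 : √(n : ℝ) ^ 2 = n := Real.sq_sqrt (by positivity)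
    have : 1 / √((n + 1 : ℕ) : ℝ) ≤ 2 * √((n + 1 : ℕ) : ℝ) - 2 * √(n : ℝ) := by
      rw [div_le_iff₀ h1]
      nlinarith [sq_nonneg (√((n + 1 : ℕ) : ℝ) - √(n : ℝ))]
    linarith

/-- The capacity of the binomial channel is at most `log (4 √n)`. -/
lemma toReal_capacity_le_log_sqrt {n : ℕ} (hn : 1 ≤ n) :
    (capacity n).toReal ≤ Real.log (4 * √n) := by
  -- As `1 / √0 = 0`, the first summand stays finite at the endpoints; the indicators add the
  -- trivial bound `1` there.
  let w : ℕ → ℝ := fun k => 1 / 2 * (1 / √(k : ℝ) + 1 / √((n - k : ℕ) : ℝ)) +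
    ((if k = 0 then 1 else 0) + (if k = n then 1 else 0))
  have hw : ∀ k ≤ n, 0 < w k := by
    intro k hk
    rcases Nat.eq_zero_or_pos k with rfl | h
    · simp only [w, if_true]; positivity
    · simp only [w]; positivity
  refine (toReal_capacity_le_log_sum n hw fun k hk x => ?_).trans ?_
  · by_cases h0 : k = 0
    · refine (bernstein_le_one n k x).trans ?_
      have : 0 ≤ 1 / 2 * (1 / √(k : ℝ) + 1 / √((n - k : ℕ) : ℝ)) := by positivity
      have h2 : (0 : ℝ) ≤ if k = n then 1 else 0 := by positivity
      simp only [w, if_pos h0]; linarith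
    by_cases h1 : k = n
    · refine (bernstein_le_one n k x).trans ?_
      have : 0 ≤ 1 / 2 * (1 / √(k : ℝ) + 1 / √((n - k : ℕ) : ℝ)) := by positivity
      have h2 : (0 : ℝ) ≤ if k = 0 then 1 else 0 := by positivity
      simp only [w, if_pos h1]; linarith
    · refine (bernstein_le_of_add_eq (m := n - k) h0 (by omega) (by omega) x).trans ?_
      simp [w, h0, h1]
  · refine Real.log_le_log (Finset.sum_pos (fun k hk => hw k (by
      simpa [Nat.lt_succ_iff] using hk)) ⟨0, by simp⟩) ?_
    have hs := sum_one_div_sqrt_le n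
    have hr : ∑ k ∈ Finset.range (n + 1), 1 / √((n - k : ℕ) : ℝ) =
        ∑ k ∈ Finset.range (n + 1), 1 / √(k : ℝ) := by
      simpa using Finset.sum_range_reflect (fun k => 1 / √(k : ℝ)) (n + 1)
    have h1 : 1 ≤ √(n : ℝ) := by rw [Real.one_le_sqrt]; exact_mod_cast hn
    simp only [w, Finset.sum_add_distrib, Finset.sum_ite_eq', ← Finset.mul_sum]
    rw [hr, if_pos (by simp), if_pos (by simp)]
    linarith

/-- The bound `log (4 √n)` is already smaller: `log 4 ≤ log π + 3/2`, and the remaining extra terms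
are nonnegative. -/
lemma toReal_capacity_le_of_stirling {n : ℕ} (hn : 1 ≤ n) :
    (capacity n).toReal ≤ Real.log (Real.pi * ((n : ℝ) + 1)) - 1 / 2 * Real.log n
            + 3 / 2 + 1 / 2 ^ (n + 1) * Real.log n
            + 1 / 2 * Real.log (3 / 2 * (1 + 1 / (n : ℝ))) := by
  refine (toReal_capacity_le_log_sqrt hn).trans ?_
  have hn1 : (1 : ℝ) ≤ n := by exact_mod_cast hn
  have hn0 : (0 : ℝ) < n := by linarith
  rw [Real.log_mul (by norm_num) (by positivity), Real.log_sqrt hn0.le,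
    Real.log_mul (by positivity) (by positivity)]
  have h1 : Real.log n ≤ Real.log (n + 1) := Real.log_le_log hn0 (by linarith)
  have h2 : 0 ≤ 1 / 2 ^ (n + 1) * Real.log n := mul_nonneg (by positivity) (Real.log_nonneg hn1)
  have h3 : 0 ≤ Real.log (3 / 2 * (1 + 1 / (n : ℝ))) := Real.log_nonneg (by
    have : 0 ≤ 1 / (n : ℝ) := by positivity
    linarith)
  have h4 : Real.log 4 ≤ Real.log Real.pi + 3 / 2 := by
    have : Real.log (4 / Real.pi) ≤ 4 / Real.pi - 1 :=
      Real.log_le_sub_one_of_pos (by positivity)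
    rw [Real.log_div (by norm_num) (by positivity)] at this
    have h5 : 4 / Real.pi ≤ 4 / 3 := by gcongr; exact Real.pi_gt_three.le
    linarith
  linarith

/-! ### Gaussian bound for the binomial entropy -/

/-- Gibbs' inequality for finite sums. -/
lemma sum_mul_log_le_sum_mul_log {ι : Type*} (s : Finset ι) {p g : ι → ℝ}
    (hp : ∀ i ∈ s, 0 ≤ p i) (hg : ∀ i ∈ s, 0 < g i) (h : ∑ i ∈ s, g i ≤ ∑ i ∈ s, p i) :
    ∑ i ∈ s, p i * Real.log (g i) ≤ ∑ i ∈ s, p i * Real.log (p i) := by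
  have h1 : ∀ i ∈ s, p i * Real.log (g i) - p i * Real.log (p i) ≤ g i - p i := by
    intro i hi
    rcases (hp i hi).eq_or_lt with h0 | h0
    · rw [← h0]; simpa using (hg i hi).le
    · have := Real.log_le_sub_one_of_pos (div_pos (hg i hi) h0)
      rw [Real.log_div (hg i hi).ne' h0.ne'] at this
      have := mul_le_mul_of_nonneg_left this h0.le
      have h3 : p i * (g i / p i - 1) = g i - p i := by field_simp
      linarith
  have h2 := Finset.sum_le_sum h1
  rw [Finset.sum_sub_distrib, Finset.sum_sub_distrib] at h2
  linarith

/-- Jensen's inequality for `exp` on a unit cell centred at `c`: the mean of `(t - μ)²` there is `(c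
- μ)² + 1/12`. This makes the discretised Gaussian weights sum to at most the full Gaussian
integral. -/
lemma exp_le_integral_gaussian_cell (b c μ : ℝ) :
    Real.exp (-b * ((c - μ) ^ 2 + 1 / 12)) ≤
      ∫ t in (c - 1 / 2)..(c + 1 / 2), Real.exp (-b * (t - μ) ^ 2) := by
  set v : ℝ := -b * ((c - μ) ^ 2 + 1 / 12) with hv
  -- The integrand is the tangent line of `exp` at the mean exponent `v`, evaluated at `-b (t -
  -- μ)²`.
  have hpoly : ∫ t in (c - 1 / 2)..(c + 1 / 2),
      Real.exp v * ((1 - v) + -b * (t - μ) ^ 2) = Real.exp v := by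
    have h1 : ∫ t in (c - 1 / 2)..(c + 1 / 2), (t - μ) ^ 2 = (c - μ) ^ 2 + 1 / 12 := by
      rw [intervalIntegral.integral_comp_sub_right (fun t => t ^ 2) μ, integral_pow]
      push_cast; ring
    rw [intervalIntegral.integral_const_mul, intervalIntegral.integral_add
      (Continuous.intervalIntegrable (by fun_prop) _ _)
      (Continuous.intervalIntegrable (by fun_prop) _ _), intervalIntegral.integral_const_mul, h1,
      intervalIntegral.integral_const, ← hv]
    simp only [smul_eq_mul]; ring
  rw [← hpoly]
  refine intervalIntegral.integral_mono_on (by linarith)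
    (Continuous.intervalIntegrable (by fun_prop) _ _)
    (Continuous.intervalIntegrable (by fun_prop) _ _) fun t _ => ?_
  have := Real.add_one_le_exp (-b * (t - μ) ^ 2 - v)
  calc Real.exp v * ((1 - v) + -b * (t - μ) ^ 2)
      ≤ Real.exp v * Real.exp (-b * (t - μ) ^ 2 - v) := by
        refine mul_le_mul_of_nonneg_left ?_ (Real.exp_pos _).le
        linarith
    _ = _ := by rw [← Real.exp_add]; congr 1; ring

lemma sum_exp_neg_mul_sq_le {b : ℝ} (hb : 0 < b) (n : ℕ) (μ : ℝ) :
    ∑ k ∈ Finset.range (n + 1), Real.exp (-b * (((k : ℝ) - μ) ^ 2 + 1 / 12)) ≤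
      √(Real.pi / b) := by
  let a : ℕ → ℝ := fun k => (k : ℝ) - 1 / 2
  have ha : ∀ k : ℕ, a (k + 1) = (k : ℝ) + 1 / 2 := fun k => by simp only [a]; push_cast; ring
  have hint : Integrable fun t : ℝ => Real.exp (-b * (t - μ) ^ 2) :=
    (integrable_exp_neg_mul_sq hb).comp_sub_right μ
  calc _ ≤ ∑ k ∈ Finset.range (n + 1), ∫ t in (a k)..(a (k + 1)), Real.exp (-b * (t - μ) ^ 2) := by
        refine Finset.sum_le_sum fun k _ => ?_
        rw [ha]; exact exp_le_integral_gaussian_cell b k μ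
    _ = ∫ t in (a 0)..(a (n + 1)), Real.exp (-b * (t - μ) ^ 2) :=
        intervalIntegral.sum_integral_adjacent_intervals fun k _ =>
          Continuous.intervalIntegrable (by fun_prop) _ _
    _ ≤ ∫ t, Real.exp (-b * (t - μ) ^ 2) := by
        rw [intervalIntegral.integral_of_le (by
          rw [ha]; simp only [a]; push_cast; linarith [Nat.cast_nonneg (α := ℝ) n])]
        exact setIntegral_le_integral hint (ae_of_all _ fun t => (Real.exp_pos _).le)
    _ = _ := by
        rw [integral_sub_right_eq_self (fun t => Real.exp (-b * t ^ 2)) μ, integral_gaussian]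

lemma sum_sub_sq_mul_bernstein (n : ℕ) (x : I) :
    ∑ k ∈ Finset.range (n + 1), ((k : ℝ) - n * x) ^ 2 * bernstein n k x =
      n * (x * (1 - x)) := by
  have h := congrArg (Polynomial.eval (x : ℝ)) (bernsteinPolynomial.variance ℝ n)
  simp only [Polynomial.eval_finsetSum, Polynomial.eval_mul, Polynomial.eval_pow,
    Polynomial.eval_sub, nsmul_eq_mul, Polynomial.eval_natCast, Polynomial.eval_X,
    Polynomial.eval_one, bernsteinPolynomial] at h
  rw [← mul_assoc, ← h]
  refine Finset.sum_congr rfl fun k _ => ?_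
  rw [bernstein_apply]; ring

/-- The entropy of a binomial law is at most a Gaussian cross entropy. -/
lemma neg_sum_bernstein_mul_log_le {b : ℝ} (hb : 0 < b) (n : ℕ) (x : I) :
    -∑ k ∈ Finset.range (n + 1), bernstein n k x * Real.log (bernstein n k x) ≤
      1 / 2 * Real.log (Real.pi / b) + b * (n * (x * (1 - x)) + 1 / 12) := by
  have hpos : 0 < √(Real.pi / b) := by positivity
  have h := sum_mul_log_le_sum_mul_log (Finset.range (n + 1)) (p := fun k => bernstein n k x)
    (g := fun k => Real.exp (-b * (((k : ℝ) - n * x) ^ 2 + 1 / 12)) / √(Real.pi / b))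
    (fun _ _ => bernstein_nonneg) (fun _ _ => by positivity) (by
      rw [sum_bernstein, ← Finset.sum_div, div_le_one hpos]
      exact sum_exp_neg_mul_sq_le hb n _)
  have h2 : ∑ k ∈ Finset.range (n + 1), bernstein n k x *
      Real.log (Real.exp (-b * (((k : ℝ) - n * x) ^ 2 + 1 / 12)) / √(Real.pi / b)) =
      -(1 / 2 * Real.log (Real.pi / b) + b * (n * (x * (1 - x)) + 1 / 12)) := by
    have h3 : ∀ k ∈ Finset.range (n + 1), bernstein n k x *
        Real.log (Real.exp (-b * (((k : ℝ) - n * x) ^ 2 + 1 / 12)) / √(Real.pi / b)) =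
        -b * (((k : ℝ) - n * x) ^ 2 * bernstein n k x) +
          (-(b / 12) - 1 / 2 * Real.log (Real.pi / b)) * bernstein n k x := by
      intro k _
      rw [Real.log_div (Real.exp_pos _).ne' hpos.ne', Real.log_exp, Real.log_sqrt (by positivity)]
      ring
    rw [Finset.sum_congr rfl h3, Finset.sum_add_distrib, ← Finset.mul_sum, ← Finset.mul_sum,
      sum_bernstein, sum_sub_sq_mul_bernstein]
    ring
  linarith

/-! ### The arcsine law: angular form, logarithmic and polynomial moments -/

lemma beta_half_half : beta (1 / 2) (1 / 2) = Real.pi := by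
  rw [beta, Real.Gamma_one_half_eq]
  norm_num
  exact Real.mul_self_sqrt Real.pi_pos.le

/-- The map `θ ↦ sin θ ^ 2` into the unit interval. -/
noncomputable def sinSq (θ : ℝ) : I :=
  ⟨Real.sin θ ^ 2, sq_nonneg _, Real.sin_sq_le_one θ⟩

lemma measurable_sinSq : Measurable sinSq :=
  Measurable.subtype_mk (by fun_prop)

lemma image_sin_sq_Ioo :
    (fun θ : ℝ => Real.sin θ ^ 2) '' Set.Ioo 0 (Real.pi / 2) = Set.Ioo 0 1 := by
  ext x
  constructor
  · rintro ⟨θ, ⟨h0, h1⟩, rfl⟩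
    have hs : 0 < Real.sin θ := Real.sin_pos_of_pos_of_lt_pi h0 (by linarith [Real.pi_pos])
    have hc : 0 < Real.cos θ := Real.cos_pos_of_mem_Ioo ⟨by linarith [Real.pi_pos], h1⟩
    have := Real.sin_sq_add_cos_sq θ
    exact ⟨by positivity, by show Real.sin θ ^ 2 < 1; nlinarith [pow_pos hc 2]⟩
  · rintro ⟨h0, h1⟩
    have hs0 : 0 < √x := Real.sqrt_pos.2 h0
    have hs1 : √x < 1 := by rw [Real.sqrt_lt' one_pos]; simpa using h1
    refine ⟨Real.arcsin √x, ⟨Real.arcsin_pos.2 hs0, Real.arcsin_lt_pi_div_two.2 hs1⟩, ?_⟩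
    simp only
    rw [Real.sin_arcsin (by linarith) hs1.le, Real.sq_sqrt h0.le]

lemma betaMeasure_half_half_eq_map :
    betaMeasure (1 / 2) (1 / 2) = ENNReal.ofReal (2 / Real.pi) •
      (volume.restrict (Set.Ioo 0 (Real.pi / 2))).map (fun θ : ℝ => Real.sin θ ^ 2) := by
  have hm : Measurable fun θ : ℝ => Real.sin θ ^ 2 := by fun_prop
  have hpdf : Measurable (betaPDF (1 / 2) (1 / 2)) :=
    (measurable_betaPDFReal _ _).ennreal_ofReal
  refine Measure.ext_of_lintegral _ fun f hf => ?_
  rw [betaMeasure, lintegral_withDensity_eq_lintegral_mul _ hpdf hf, lintegral_smul_measure,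
    lintegral_map hf hm]
  have h1 : ∫⁻ x, (betaPDF (1 / 2) (1 / 2) * f) x =
      ∫⁻ x in Set.Ioo 0 1, (betaPDF (1 / 2) (1 / 2) * f) x := by
    rw [setLIntegral_eq_of_support_subset]
    intro x hx
    by_contra hx'
    rw [Set.mem_Ioo] at hx'
    refine hx ?_
    have : betaPDF (1 / 2) (1 / 2) x = 0 := by
      rw [betaPDF_eq, if_neg hx', ENNReal.ofReal_zero]
    rw [Pi.mul_apply, this, zero_mul]
  have hinj : Set.InjOn (fun θ : ℝ => Real.sin θ ^ 2) (Set.Ioo 0 (Real.pi / 2)) := by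
    intro a ha b hb hab
    have hsa : 0 ≤ Real.sin a :=
      (Real.sin_pos_of_pos_of_lt_pi ha.1 (by linarith [ha.2, Real.pi_pos])).le
    have hsb : 0 ≤ Real.sin b :=
      (Real.sin_pos_of_pos_of_lt_pi hb.1 (by linarith [hb.2, Real.pi_pos])).le
    refine Real.injOn_sin ⟨?_, ha.2.le⟩ ⟨?_, hb.2.le⟩ ((sq_eq_sq₀ hsa hsb).1 hab)
    · linarith [ha.1, Real.pi_pos]
    · linarith [hb.1, Real.pi_pos]
  have hd : ∀ θ ∈ Set.Ioo 0 (Real.pi / 2), HasDerivWithinAt (fun θ : ℝ => Real.sin θ ^ 2)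
      (2 * Real.sin θ * Real.cos θ) (Set.Ioo 0 (Real.pi / 2)) θ := fun θ _ =>
    (((Real.hasDerivAt_sin θ).fun_pow 2).congr_deriv (by norm_num)).hasDerivWithinAt
  rw [h1, ← image_sin_sq_Ioo, lintegral_image_eq_lintegral_abs_deriv_mul measurableSet_Ioo hd hinj,
    smul_eq_mul, ← lintegral_const_mul _ (show Measurable fun θ : ℝ => f (Real.sin θ ^ 2) from
      hf.comp hm)]
  refine setLIntegral_congr_fun measurableSet_Ioo fun θ hθ => ?_
  have hs : 0 < Real.sin θ :=
    Real.sin_pos_of_pos_of_lt_pi hθ.1 (by linarith [hθ.2, Real.pi_pos])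
  have hc : 0 < Real.cos θ := Real.cos_pos_of_mem_Ioo ⟨by linarith [hθ.1, Real.pi_pos], hθ.2⟩
  have hmem : Real.sin θ ^ 2 ∈ Set.Ioo (0 : ℝ) 1 := image_sin_sq_Ioo ▸ ⟨θ, hθ, rfl⟩
  have hpow : ∀ t : ℝ, 0 < t → (t ^ 2) ^ ((1 / 2 : ℝ) - 1) = t⁻¹ := fun t ht => by
    rw [← Real.rpow_natCast, ← Real.rpow_mul ht.le]
    norm_num [Real.rpow_neg_one]
  simp only [Pi.mul_apply]
  rw [betaPDF_of_pos_lt_one hmem.1 hmem.2, ← mul_assoc, ← ENNReal.ofReal_mul (abs_nonneg _),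
    beta_half_half, abs_of_pos (by positivity),
    show 1 - Real.sin θ ^ 2 = Real.cos θ ^ 2 by linarith [Real.sin_sq_add_cos_sq θ],
    hpow _ hs, hpow _ hc]
  congr 2
  field_simp

/-- The arcsine law is the law of `sin θ ^ 2` for an angle `θ` uniform on `(0, π / 2)`. -/
lemma arcsineLaw_eq_map : (arcsineLaw : Measure I) = ENNReal.ofReal (2 / Real.pi) •
    (volume.restrict (Set.Ioo 0 (Real.pi / 2))).map sinSq := by
  have he : MeasurableEmbedding ((↑) : I → ℝ) := MeasurableEmbedding.subtype_coe measurableSet_Icc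
  have h1 : betaMeasure (1 / 2) (1 / 2) = (ENNReal.ofReal (2 / Real.pi) •
      (volume.restrict (Set.Ioo 0 (Real.pi / 2))).map sinSq).map ((↑) : I → ℝ) := by
    rw [betaMeasure_half_half_eq_map, Measure.map_smul, Measure.map_map he.measurable
      measurable_sinSq]
    rfl
  change (betaMeasure (1 / 2) (1 / 2)).comap ((↑) : I → ℝ) = _
  rw [h1, he.comap_map]

lemma integral_arcsineLaw {f : I → ℝ} (hf : Measurable f) :
    ∫ x, f x ∂(arcsineLaw : Measure I) =
      2 / Real.pi * ∫ θ in (0)..(Real.pi / 2), f (sinSq θ) := by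
  rw [arcsineLaw_eq_map, integral_smul_measure, integral_map measurable_sinSq.aemeasurable
    hf.aestronglyMeasurable, intervalIntegral.integral_of_le (by positivity),
    integral_Ioc_eq_integral_Ioo, ENNReal.toReal_ofReal (by positivity), smul_eq_mul]

lemma integrable_arcsineLaw {f : I → ℝ} (hf : Measurable f)
    (h : IntervalIntegrable (fun θ => f (sinSq θ)) volume 0 (Real.pi / 2)) :
    Integrable f (arcsineLaw : Measure I) := by
  rw [intervalIntegrable_iff_integrableOn_Ioo_of_le (by positivity)] at h
  rw [arcsineLaw_eq_map]
  refine Integrable.smul_measure ?_ ENNReal.ofReal_ne_top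
  exact (integrable_map_measure hf.aestronglyMeasurable measurable_sinSq.aemeasurable).2 h

lemma integral_log_cos_zero_pi_div_two :
    ∫ θ in (0)..(Real.pi / 2), Real.log (Real.cos θ) = -Real.log 2 * Real.pi / 2 := by
  rw [← integral_log_sin_zero_pi_div_two]
  have := intervalIntegral.integral_comp_sub_left (a := 0) (b := Real.pi / 2)
    (fun t => Real.log (Real.sin t)) (Real.pi / 2)
  simpa [Real.sin_pi_div_two_sub] using this

lemma coe_sinSq (θ : ℝ) : (sinSq θ : ℝ) = Real.sin θ ^ 2 := rfl

lemma one_sub_coe_sinSq (θ : ℝ) : 1 - (sinSq θ : ℝ) = Real.cos θ ^ 2 := by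
  rw [coe_sinSq]; linarith [Real.sin_sq_add_cos_sq θ]

/-- In the angle, `log x` becomes `2 log sin θ`, and Euler's integral of `log sin` applies. -/
lemma arcsineLaw_log : Integrable (fun x : I => Real.log x) (arcsineLaw : Measure I) ∧
    ∫ x : I, Real.log x ∂(arcsineLaw : Measure I) = -2 * Real.log 2 := by
  have hm : Measurable fun x : I => Real.log x := Real.measurable_log.comp measurable_subtype_coe
  have h : ∀ θ, Real.log (sinSq θ) = 2 * Real.log (Real.sin θ) := fun θ => by
    rw [coe_sinSq, Real.log_pow]; norm_num
  constructor
  · refine integrable_arcsineLaw hm ?_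
    simp_rw [h]
    exact (intervalIntegrable_log_sin).const_mul 2
  · rw [integral_arcsineLaw hm]
    simp_rw [h]
    rw [intervalIntegral.integral_const_mul, integral_log_sin_zero_pi_div_two]
    field_simp

lemma arcsineLaw_log_one_sub :
    Integrable (fun x : I => Real.log (1 - x)) (arcsineLaw : Measure I) ∧
    ∫ x : I, Real.log (1 - x) ∂(arcsineLaw : Measure I) = -2 * Real.log 2 := by
  have hm : Measurable fun x : I => Real.log (1 - x) :=
    Real.measurable_log.comp (measurable_subtype_coe.const_sub 1)
  have h : ∀ θ, Real.log (1 - sinSq θ) = 2 * Real.log (Real.cos θ) := fun θ => by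
    rw [one_sub_coe_sinSq, Real.log_pow]; norm_num
  constructor
  · refine integrable_arcsineLaw hm ?_
    simp_rw [h]
    exact (intervalIntegrable_log_cos).const_mul 2
  · rw [integral_arcsineLaw hm]
    simp_rw [h]
    rw [intervalIntegral.integral_const_mul, integral_log_cos_zero_pi_div_two]
    field_simp

lemma ae_arcsineLaw_mem_Ioo : ∀ᵐ x : I ∂(arcsineLaw : Measure I), 0 < (x : ℝ) ∧ (x : ℝ) < 1 := by
  rw [arcsineLaw_eq_map]
  refine Measure.ae_smul_measure ?_ _
  refine (ae_map_iff (p := fun x : I => 0 < (x : ℝ) ∧ (x : ℝ) < 1) measurable_sinSq.aemeasurable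
    ((measurableSet_Ioo (a := (0 : ℝ)) (b := 1)).preimage measurable_subtype_coe)).2 ?_
  refine (ae_restrict_iff' measurableSet_Ioo).2 (ae_of_all _ fun θ hθ => ?_)
  exact (image_sin_sq_Ioo ▸ ⟨θ, hθ, rfl⟩ : Real.sin θ ^ 2 ∈ Set.Ioo (0 : ℝ) 1)

/-- The moments of the arcsine law. -/
lemma integral_pow_mul_one_sub_pow_arcsineLaw (k m : ℕ) :
    ∫ x : I, (x : ℝ) ^ k * (1 - (x : ℝ)) ^ m ∂(arcsineLaw : Measure I) =
      beta (k + 1 / 2) (m + 1 / 2) / Real.pi := by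
  have hb : 0 < beta (k + 1 / 2) (m + 1 / 2) := beta_pos (by positivity) (by positivity)
  have hpdf : ∀ α β, Measurable (betaPDF α β) := fun α β =>
    (measurable_betaPDFReal _ _).ennreal_ofReal
  have hm : Measurable fun x : ℝ => ENNReal.ofReal (x ^ k * (1 - x) ^ m) := by fun_prop
  have h1 : ∫⁻ x, ENNReal.ofReal (x ^ k * (1 - x) ^ m) ∂betaMeasure (1 / 2) (1 / 2) =
      ENNReal.ofReal (beta (k + 1 / 2) (m + 1 / 2) / Real.pi) := by
    rw [betaMeasure, lintegral_withDensity_eq_lintegral_mul _ (hpdf _ _) hm]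
    -- The factor `1` is written as the total mass of `Beta(k + 1/2, m + 1/2)`, whose density is
    -- proportional to the integrand.
    rw [← mul_one (ENNReal.ofReal (beta (k + 1 / 2) (m + 1 / 2) / Real.pi)),
      ← lintegral_betaPDF_eq_one (α := k + 1 / 2) (β := m + 1 / 2) (by positivity) (by positivity),
      ← lintegral_const_mul _ (hpdf _ _)]
    refine lintegral_congr fun x => ?_
    simp only [Pi.mul_apply]
    by_cases hx : 0 < x ∧ x < 1
    · have hx1 : 0 < 1 - x := sub_pos.2 hx.2
      rw [betaPDF_of_pos_lt_one hx.1 hx.2, betaPDF_of_pos_lt_one hx.1 hx.2,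
        ← ENNReal.ofReal_mul (by rw [beta_half_half]; have := hx.1; positivity),
        ← ENNReal.ofReal_mul (div_nonneg hb.le Real.pi_pos.le), beta_half_half,
        show (k : ℝ) + 1 / 2 - 1 = (1 / 2 - 1) + k by ring,
        show (m : ℝ) + 1 / 2 - 1 = (1 / 2 - 1) + m by ring,
        Real.rpow_add hx.1, Real.rpow_add hx1, Real.rpow_natCast, Real.rpow_natCast]
      congr 1
      generalize beta (k + 1 / 2) (m + 1 / 2) = B at hb ⊢
      field_simp
    · simp [betaPDF_eq, hx]
  have he : MeasurableEmbedding ((↑) : I → ℝ) := MeasurableEmbedding.subtype_coe measurableSet_Icc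
  have h2 : (arcsineLaw : Measure I).map ((↑) : I → ℝ) = betaMeasure (1 / 2) (1 / 2) := by
    rw [arcsineLaw_eq_map, betaMeasure_half_half_eq_map, Measure.map_smul,
      Measure.map_map he.measurable measurable_sinSq]
    rfl
  rw [integral_eq_lintegral_of_nonneg_ae
    (ae_of_all _ fun x : I => mul_nonneg (pow_nonneg x.2.1 _) (pow_nonneg (sub_nonneg.2 x.2.2) _))
    (Continuous.aestronglyMeasurable (by fun_prop))]
  rw [← h2, lintegral_map hm he.measurable] at h1
  rw [h1, ENNReal.toReal_ofReal (by positivity)]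

/-! ### Output entropy under the arcsine law -/

/-- The normalized ratio `Γ(k + 1/2) / (k! √π)`, which equals `(2k choose k) / 4 ^ k`. -/
noncomputable def gammaRatio (k : ℕ) : ℝ := Real.Gamma (k + 1 / 2) / (k.factorial * √Real.pi)

lemma gammaRatio_pos (k : ℕ) : 0 < gammaRatio k := by
  have : 0 < Real.Gamma ((k : ℝ) + 1 / 2) := Real.Gamma_pos_of_pos (by positivity)
  unfold gammaRatio; positivity

/-- The classical central binomial estimate. The inductive step is `(2k+1)² (3k+4) ≤ (2k+2)²
(3k+1)`, whose two sides differ by `k`. -/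
lemma gammaRatio_sq_mul_le (k : ℕ) : gammaRatio k ^ 2 * (3 * k + 1) ≤ 1 := by
  induction k with
  | zero =>
    have : √Real.pi ≠ 0 := by positivity
    simp only [gammaRatio, Nat.cast_zero, zero_add, Real.Gamma_one_half_eq, Nat.factorial_zero,
      Nat.cast_one, one_mul, div_self this]
    norm_num
  | succ k ih =>
    have h : gammaRatio (k + 1) = gammaRatio k * ((k + 1 / 2) / (k + 1)) := by
      simp only [gammaRatio, Nat.factorial_succ]
      push_cast
      rw [show (k : ℝ) + 1 + 1 / 2 = (k + 1 / 2) + 1 by ring,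
        Real.Gamma_add_one (by positivity)]
      have : √Real.pi ≠ 0 := by positivity
      field_simp
    refine le_trans ?_ ih
    rw [h, mul_pow, mul_assoc]
    refine mul_le_mul_of_nonneg_left ?_ (sq_nonneg _)
    push_cast
    rw [div_pow, div_mul_eq_mul_div, div_le_iff₀ (by positivity)]
    nlinarith [Nat.cast_nonneg (α := ℝ) k]

lemma outputProb_arcsineLaw (k m : ℕ) :
    outputProb (k + m) (arcsineLaw : Measure I) k = gammaRatio k * gammaRatio m := by
  have h : ∀ x : I, bernstein (k + m) k x =
      ((k + m).choose k : ℝ) * ((x : ℝ) ^ k * (1 - (x : ℝ)) ^ m) := fun x => by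
    rw [bernstein_apply, show k + m - k = m by omega, mul_assoc]
  simp only [outputProb, h]
  rw [integral_const_mul, integral_pow_mul_one_sub_pow_arcsineLaw, beta, gammaRatio, gammaRatio,
    show (k : ℝ) + 1 / 2 + (m + 1 / 2) = ((k + m : ℕ) : ℝ) + 1 by push_cast; ring,
    Real.Gamma_nat_eq_factorial]
  have hC : (((k + m).choose k : ℕ) : ℝ) * k.factorial * m.factorial = (k + m).factorial := by
    rw [Nat.choose_symm_add]
    exact_mod_cast Nat.add_choose_mul_factorial_mul_factorial k m
  rw [← hC]
  have hC0 : (((k + m).choose k : ℕ) : ℝ) ≠ 0 := by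
    exact_mod_cast (Nat.choose_pos (Nat.le_add_right k m)).ne'
  have hpi : √Real.pi * √Real.pi = Real.pi := Real.mul_self_sqrt Real.pi_pos.le
  rw [div_mul_div_comm, show (k.factorial : ℝ) * √Real.pi * (m.factorial * √Real.pi) =
    k.factorial * m.factorial * (√Real.pi * √Real.pi) by ring, hpi]
  field_simp

/-- The factors `3k+1` and `3m+1` are traded for `k+1` and `m+1`, since `1/(k+1)` has a tractable
binomial mean. The constant `2` survives because `k + m ≥ 1`; it would fail at `k = m = 0`. -/
lemma log_outputProb_arcsineLaw_le {k m : ℕ} (h : 1 ≤ k + m) :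
    Real.log (outputProb (k + m) (arcsineLaw : Measure I) k) ≤
      -(1 / 2 * (Real.log 2 + Real.log (k + 1) + Real.log (m + 1))) := by
  rw [outputProb_arcsineLaw]
  have hk := gammaRatio_pos k
  have hm := gammaRatio_pos m
  have h1 : (gammaRatio k * gammaRatio m) ^ 2 * (2 * ((k : ℝ) + 1) * (m + 1)) ≤ 1 := by
    have h2 : 2 * ((k : ℝ) + 1) * (m + 1) ≤ (3 * k + 1) * (3 * m + 1) := by
      have h3 : (1 : ℝ) ≤ k + m := by exact_mod_cast h
      have : (0 : ℝ) ≤ k * m := by positivity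
      nlinarith
    calc _ ≤ (gammaRatio k * gammaRatio m) ^ 2 * ((3 * k + 1) * (3 * m + 1)) := by gcongr
      _ = (gammaRatio k ^ 2 * (3 * k + 1)) * (gammaRatio m ^ 2 * (3 * m + 1)) := by ring
      _ ≤ 1 := mul_le_one₀ (gammaRatio_sq_mul_le k) (by positivity) (gammaRatio_sq_mul_le m)
  have h2 := Real.log_nonpos (by positivity) h1
  rw [Real.log_mul (by positivity) (by positivity), Real.log_pow,
    Real.log_mul (show 2 * ((k : ℝ) + 1) ≠ 0 by positivity) (by positivity),
    Real.log_mul two_ne_zero (show (k : ℝ) + 1 ≠ 0 by positivity)] at h2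
  push_cast at h2
  linarith

/-- Absorbing `(n+1)x / (k+1)` shifts the likelihood to index `k+1` for `n+1` trials; only the term
of index `0` is missing from a total of `1`. -/
lemma sum_bernstein_div_succ_le (n : ℕ) (x : I) :
    ((n : ℝ) + 1) * x * ∑ k ∈ Finset.range (n + 1), bernstein n k x / ((k : ℝ) + 1) ≤ 1 := by
  have h : ∀ k ∈ Finset.range (n + 1), ((n : ℝ) + 1) * x * (bernstein n k x / ((k : ℝ) + 1)) =
      bernstein (n + 1) (k + 1) x := by
    intro k _
    have hc : ((n : ℝ) + 1) * n.choose k = (n + 1).choose (k + 1) * ((k : ℝ) + 1) := by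
      exact_mod_cast Nat.add_one_mul_choose_eq n k
    rw [bernstein_apply, bernstein_apply, Nat.add_sub_add_right]
    have hk : (k : ℝ) + 1 ≠ 0 := by positivity
    field_simp
    calc _ = (((n : ℝ) + 1) * n.choose k) * ((x : ℝ) ^ (k + 1) * (1 - (x : ℝ)) ^ (n - k)) := by ring
      _ = _ := by rw [hc]; ring
  rw [Finset.mul_sum, Finset.sum_congr rfl h, ← sum_bernstein (n + 1) x,
    Finset.sum_range_succ' _ (n + 1)]
  linarith [bernstein_nonneg (n := n + 1) (ν := 0) (x := x)]

/-- Jensen's inequality in the variable `1/(k+1)`, through `log (k+1) ≥ log c + 1 - c/(k+1)` with `c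
= (n+1)x`. -/
lemma log_le_sum_bernstein_mul_log (n : ℕ) {x : I} (hx : 0 < (x : ℝ)) :
    Real.log (n + 1) + Real.log x ≤
      ∑ k ∈ Finset.range (n + 1), bernstein n k x * Real.log ((k : ℝ) + 1) := by
  set c : ℝ := ((n : ℝ) + 1) * x with hc
  have hc0 : 0 < c := by positivity
  rw [← Real.log_mul (by positivity) hx.ne', ← hc]
  have h : ∀ k ∈ Finset.range (n + 1), bernstein n k x * (Real.log c + 1) -
      c * (bernstein n k x / ((k : ℝ) + 1)) ≤ bernstein n k x * Real.log ((k : ℝ) + 1) := by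
    intro k _
    have hk : (0 : ℝ) < (k : ℝ) + 1 := by positivity
    have h1 := Real.log_le_sub_one_of_pos (div_pos hc0 hk)
    rw [Real.log_div hc0.ne' hk.ne'] at h1
    have := mul_le_mul_of_nonneg_left h1 (bernstein_nonneg (n := n) (ν := k) (x := x))
    have h3 : bernstein n k x * (c / ((k : ℝ) + 1) - 1) =
      c * (bernstein n k x / ((k : ℝ) + 1)) - bernstein n k x := by ring
    linarith
  have h2 := Finset.sum_le_sum h
  rw [Finset.sum_sub_distrib, ← Finset.sum_mul, ← Finset.mul_sum, sum_bernstein] at h2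
  have := sum_bernstein_div_succ_le n x
  rw [← hc] at this
  linarith

lemma bernstein_sub_eq_symm {n k : ℕ} (hk : k ≤ n) (x : I) :
    bernstein n (n - k) x = bernstein n k (unitInterval.symm x) := by
  rw [bernstein_apply, bernstein_apply, Nat.choose_symm hk, unitInterval.coe_symm_eq,
    Nat.sub_sub_self hk]
  ring

lemma log_one_sub_le_sum_bernstein_mul_log (n : ℕ) {x : I} (hx : (x : ℝ) < 1) :
    Real.log (n + 1) + Real.log (1 - x) ≤
      ∑ k ∈ Finset.range (n + 1), bernstein n k x * Real.log (((n - k : ℕ) : ℝ) + 1) := by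
  have h := log_le_sum_bernstein_mul_log n (x := unitInterval.symm x)
    (by rw [unitInterval.coe_symm_eq]; linarith)
  rw [unitInterval.coe_symm_eq] at h
  refine h.trans (le_of_eq ?_)
  rw [← Finset.sum_range_reflect]
  refine Finset.sum_congr rfl fun k hk => ?_
  have hk' : k ≤ n := by simpa [Nat.lt_succ_iff] using hk
  rw [show n + 1 - 1 - k = n - k by omega, ← bernstein_sub_eq_symm (Nat.sub_le n k),
    Nat.sub_sub_self hk']

lemma sum_outputProb_mul_log_arcsineLaw_le {n : ℕ} (hn : 1 ≤ n) :
    ∑ k ∈ Finset.range (n + 1), outputProb n (arcsineLaw : Measure I) k *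
        Real.log (outputProb n (arcsineLaw : Measure I) k) ≤
      3 / 2 * Real.log 2 - Real.log (n + 1) := by
  set μ : Measure I := (arcsineLaw : Measure I) with hμ
  let g : ℕ → ℝ := fun k => Real.log ((k : ℝ) + 1) + Real.log (((n - k : ℕ) : ℝ) + 1)
  have h1 : ∀ k ∈ Finset.range (n + 1), outputProb n μ k * Real.log (outputProb n μ k) ≤
      -(1 / 2 * Real.log 2) * outputProb n μ k - 1 / 2 * (outputProb n μ k * g k) := by
    intro k hk
    have hk' : k ≤ n := by simpa [Nat.lt_succ_iff] using hk
    obtain ⟨m, rfl⟩ := Nat.exists_eq_add_of_le hk'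
    have := mul_le_mul_of_nonneg_left (log_outputProb_arcsineLaw_le hn)
      (outputProb_nonneg (k + m) μ k)
    refine this.trans (le_of_eq ?_)
    simp only [g, Nat.add_sub_cancel_left]
    ring
  have hint : ∀ k, Integrable (fun x : I => bernstein n k x * g k) μ := fun k =>
    (integrable_of_continuous μ (bernstein n k).continuous).mul_const _
  -- The two Jensen bounds, for `k` and for `n - k`, are averaged over the input; each logarithmic
  -- moment contributes `-2 log 2`.
  have h2 : 2 * Real.log (n + 1) - 4 * Real.log 2 ≤
      ∑ k ∈ Finset.range (n + 1), outputProb n μ k * g k := by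
    have e1 : ∑ k ∈ Finset.range (n + 1), outputProb n μ k * g k =
        ∫ x, ∑ k ∈ Finset.range (n + 1), bernstein n k x * g k ∂μ := by
      rw [integral_finsetSum _ fun k _ => hint k]
      exact Finset.sum_congr rfl fun k _ => by rw [outputProb, integral_mul_const]
    have e2 : 2 * Real.log (n + 1) - 4 * Real.log 2 =
        ∫ x : I, 2 * Real.log (n + 1) + (Real.log x + Real.log (1 - x)) ∂μ := by
      rw [integral_add (f := fun _ => 2 * Real.log (n + 1))
        (g := fun x : I => Real.log x + Real.log (1 - x)) (integrable_const _)
        (arcsineLaw_log.1.add arcsineLaw_log_one_sub.1), integral_add arcsineLaw_log.1 arcsineLaw_log_one_sub.1, arcsineLaw_log.2,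
        arcsineLaw_log_one_sub.2, integral_const]
      simp; ring
    rw [e1, e2]
    refine integral_mono_ae ((integrable_const _).add
      (arcsineLaw_log.1.add arcsineLaw_log_one_sub.1)) (integrable_finsetSum _ fun k _ => hint k) ?_
    filter_upwards [ae_arcsineLaw_mem_Ioo] with x hx
    have a1 := log_le_sum_bernstein_mul_log n hx.1
    have a2 := log_one_sub_le_sum_bernstein_mul_log n hx.2
    simp only [g, mul_add, Finset.sum_add_distrib]
    linarith
  have h3 := Finset.sum_le_sum h1
  rw [Finset.sum_sub_distrib, ← Finset.mul_sum, ← Finset.mul_sum, sum_outputProb] at h3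
  linarith

/-! ### Lower bound from the arcsine input -/

lemma integral_mul_one_sub_arcsineLaw :
    ∫ x : I, (x : ℝ) * (1 - x) ∂(arcsineLaw : Measure I) = 1 / 8 := by
  have h := integral_pow_mul_one_sub_pow_arcsineLaw 1 1
  simp only [pow_one] at h
  rw [h, beta, Nat.cast_one, show (1 : ℝ) + 1 / 2 = 1 / 2 + 1 by norm_num,
    Real.Gamma_add_one (by norm_num), Real.Gamma_one_half_eq,
    show (1 / 2 + 1 + (1 / 2 + 1) : ℝ) = (2 : ℕ) + 1 by norm_num, Real.Gamma_nat_eq_factorial,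
    show 1 / 2 * √Real.pi * (1 / 2 * √Real.pi) = 1 / 4 * (√Real.pi * √Real.pi) by ring,
    Real.mul_self_sqrt Real.pi_pos.le]
  simp
  field_simp
  norm_num

/-- A lower bound for the mutual information under the arcsine law. -/
lemma le_binomialInfo_arcsineLaw {n : ℕ} (hn : 1 ≤ n) :
    Real.log (n + 1) - 3 / 2 * Real.log 2 -
        1 / 2 * Real.log (2 * Real.pi * Real.exp 1 * ((n : ℝ) / 8 + 1 / 12)) ≤
      binomialInfo n (arcsineLaw : Measure I) := by
  set μ : Measure I := (arcsineLaw : Measure I) with hμ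
  -- One Gaussian width serves all inputs: `s` is the average over `x` of the variance `n x (1-x)`
  -- plus `1/12`, so the quadratic term averages to exactly `1/2`.
  set s : ℝ := (n : ℝ) / 8 + 1 / 12 with hs
  have hs0 : 0 < s := by positivity
  have hb : 0 < 1 / (2 * s) := by positivity
  have h1 := sum_outputProb_mul_log_arcsineLaw_le hn
  have hc : Continuous fun x : I => (x : ℝ) * (1 - x) := by fun_prop
  have h2 : -(1 / 2 * Real.log (Real.pi / (1 / (2 * s))) + 1 / (2 * s) * (n * (1 / 8) + 1 / 12)) ≤
      ∫ x, ∑ k ∈ Finset.range (n + 1), bernstein n k x * Real.log (bernstein n k x) ∂μ := by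
    have e : ∫ x : I, -(1 / 2 * Real.log (Real.pi / (1 / (2 * s))) +
        1 / (2 * s) * (n * ((x : ℝ) * (1 - x)) + 1 / 12)) ∂μ =
        -(1 / 2 * Real.log (Real.pi / (1 / (2 * s))) + 1 / (2 * s) * (n * (1 / 8) + 1 / 12)) := by
      have e1 : ∀ x : I, -(1 / 2 * Real.log (Real.pi / (1 / (2 * s))) +
          1 / (2 * s) * (n * ((x : ℝ) * (1 - x)) + 1 / 12)) =
          -(1 / (2 * s) * n) * ((x : ℝ) * (1 - x)) +
          -(1 / 2 * Real.log (Real.pi / (1 / (2 * s))) + 1 / (2 * s) * (1 / 12)) := fun x => by ring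
      simp_rw [e1]
      rw [integral_add ((integrable_of_continuous _ hc).const_mul _) (integrable_const _),
        integral_const_mul, integral_mul_one_sub_arcsineLaw, integral_const, probReal_univ,
        one_smul]
      ring
    rw [← e]
    refine integral_mono (integrable_of_continuous _ (by fun_prop)) (integrable_of_continuous _
      (continuous_finsetSum _ fun k _ => continuous_bernstein_mul_log n k)) fun x => ?_
    have := neg_sum_bernstein_mul_log_le hb n x
    simp only
    linarith
  have h3 : 1 / (2 * s) * (n * (1 / 8) + 1 / 12) = 1 / 2 := by
    rw [show (n : ℝ) * (1 / 8) + 1 / 12 = s by rw [hs]; ring]; field_simp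
  have h4 : Real.log (2 * Real.pi * Real.exp 1 * s) = Real.log (Real.pi / (1 / (2 * s))) + 1 := by
    rw [show 2 * Real.pi * Real.exp 1 * s = (Real.pi / (1 / (2 * s))) * Real.exp 1 by
      field_simp, Real.log_mul (by positivity) (Real.exp_pos _).ne', Real.log_exp]
  rw [h3] at h2
  rw [h4, binomialInfo]
  linarith

lemma le_binomialInfo_arcsineLaw' {n : ℕ} (hn : 1 ≤ n) :
    Real.log (Real.pi * n)
        - 1 / 2 * Real.log (2 * Real.pi * Real.exp 1 * ((n : ℝ) / 8 + 1 / 12))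
        + 1 / √(Real.pi * ((n : ℝ) + 1 / 4)) * Real.log (1 / (16 * (n : ℝ) ^ 2))
        - Real.log 4 - 1 ≤ binomialInfo n (arcsineLaw : Measure I) := by
  refine le_trans ?_ (le_binomialInfo_arcsineLaw hn)
  have hn1 : (1 : ℝ) ≤ n := by exact_mod_cast hn
  have hn0 : (0 : ℝ) < n := by linarith
  have h1 : 1 / √(Real.pi * ((n : ℝ) + 1 / 4)) * Real.log (1 / (16 * (n : ℝ) ^ 2)) ≤ 0 := by
    refine mul_nonpos_of_nonneg_of_nonpos (by positivity) (Real.log_nonpos (by positivity) ?_)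
    rw [div_le_one (by positivity)]
    nlinarith
  have h2 : Real.log n ≤ Real.log (n + 1) := Real.log_le_log hn0 (by linarith)
  have h4 : Real.log 4 = 2 * Real.log 2 := by
    rw [show (4 : ℝ) = 2 ^ 2 by norm_num, Real.log_pow]; norm_num
  -- The comparison of constants needs only `log π ≤ 1 + (1/2) log 2`; this bound implies it because
  -- `log 2 < 4/5`.
  have h5 : Real.log Real.pi ≤ Real.log 2 + 3 / 5 := by
    have := Real.log_le_sub_one_of_pos (show 0 < Real.pi / 2 by positivity)
    rw [Real.log_div Real.pi_pos.ne' two_ne_zero] at this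
    linarith [Real.pi_lt_d2]
  rw [Real.log_mul Real.pi_pos.ne' hn0.ne']
  have := Real.log_two_lt_d9
  linarith

lemma half_log_sub_two_le_toReal_capacity {n : ℕ} (hn : 1 ≤ n) :
    1 / 2 * Real.log n - 2 ≤ (capacity n).toReal := by
  refine le_trans ?_ ((le_binomialInfo_arcsineLaw hn).trans
    (binomialInfo_le_toReal_capacity n arcsineLaw))
  have hn1 : (1 : ℝ) ≤ n := by exact_mod_cast hn
  have hn0 : (0 : ℝ) < n := by linarith
  have h2 : Real.log n ≤ Real.log (n + 1) := Real.log_le_log hn0 (by linarith)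
  have h3 : Real.log (2 * Real.pi * Real.exp 1 * ((n : ℝ) / 8 + 1 / 12)) ≤
      Real.log 2 + 1 + Real.log n := by
    rw [mul_right_comm, Real.log_mul (by positivity) (by positivity), Real.log_exp]
    have : Real.log (2 * Real.pi * ((n : ℝ) / 8 + 1 / 12)) ≤ Real.log (2 * n) := by
      refine Real.log_le_log (by positivity) ?_
      nlinarith [Real.pi_le_four]
    rw [Real.log_mul (by norm_num) hn0.ne'] at this
    linarith
  have := Real.log_two_lt_d9
  linarith

/-! ### The two-point input -/

/-- The uniform law on the two endpoints of the unit interval. -/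
noncomputable def endpointLaw : ProbabilityMeasure I :=
  ⟨(2⁻¹ : ℝ≥0∞) • Measure.dirac 0 + (2⁻¹ : ℝ≥0∞) • Measure.dirac 1,
    ⟨by simp [ENNReal.inv_two_add_inv_two]⟩⟩

lemma integral_endpointLaw (f : I → ℝ) :
    ∫ x, f x ∂(endpointLaw : Measure I) = 1 / 2 * (f 0 + f 1) := by
  change ∫ x, f x ∂((2⁻¹ : ℝ≥0∞) • Measure.dirac 0 + (2⁻¹ : ℝ≥0∞) • Measure.dirac 1) = _
  have h : ∀ a : I, Integrable f ((2⁻¹ : ℝ≥0∞) • Measure.dirac a) := fun a =>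
    (integrable_dirac (by simp)).smul_measure (by simp)
  rw [integral_add_measure (h 0) (h 1), integral_smul_measure, integral_smul_measure,
    integral_dirac, integral_dirac]
  simp; ring

lemma bernstein_zero (n k : ℕ) : bernstein n k 0 = if k = 0 then 1 else 0 := by
  rcases eq_or_ne k 0 with h | h <;> simp [bernstein_apply, h]

lemma bernstein_one (n k : ℕ) : bernstein n k 1 = if k = n then 1 else 0 := by
  rcases lt_trichotomy k n with h | h | h
  · simp [bernstein_apply, h.ne, show n - k ≠ 0 by omega]
  · simp [bernstein_apply, h]
  · rw [bernstein_eq_zero_of_lt h, if_neg h.ne']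

/-- At an endpoint the output is deterministic, so the conditional entropy is zero. As `n ≥ 1` keeps
the outputs `0` and `n` distinct, the output is a fair bit. -/
lemma binomialInfo_endpointLaw {n : ℕ} (hn : 1 ≤ n) :
    binomialInfo n (endpointLaw : Measure I) = Real.log 2 := by
  have h0 : ∀ k, bernstein n k 0 * Real.log (bernstein n k 0) = 0 := fun k => by
    rw [bernstein_zero]; split_ifs <;> simp
  have h1 : ∀ k, bernstein n k 1 * Real.log (bernstein n k 1) = 0 := fun k => by
    rw [bernstein_one]; split_ifs <;> simp
  have h2 : ∀ k ∈ Finset.range (n + 1), outputProb n (endpointLaw : Measure I) k *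
      Real.log (outputProb n (endpointLaw : Measure I) k) =
      outputProb n (endpointLaw : Measure I) k * -Real.log 2 := by
    intro k _
    have : outputProb n (endpointLaw : Measure I) k = 0 ∨
        outputProb n (endpointLaw : Measure I) k = 2⁻¹ := by
      rw [outputProb, integral_endpointLaw, bernstein_zero, bernstein_one]
      split_ifs with h3 h4 <;> first | omega | simp
    rcases this with h | h <;> rw [h]
    · simp
    · rw [Real.log_inv]
  rw [binomialInfo, integral_endpointLaw, Finset.sum_congr rfl h2, ← Finset.sum_mul,
    sum_outputProb]
  simp [h0, h1]

/-! ### Asymptotics and the main theorem -/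

lemma abs_toReal_capacity_sub_half_log_le {n : ℕ} (hn : 1 ≤ n) :
    |(capacity n).toReal - 1 / 2 * Real.log n| ≤ 2 := by
  have hn0 : (0 : ℝ) < n := by exact_mod_cast hn
  have h1 := half_log_sub_two_le_toReal_capacity hn
  have h2 := toReal_capacity_le_log_sqrt hn
  rw [Real.log_mul (by norm_num) (by positivity), Real.log_sqrt hn0.le,
    show (4 : ℝ) = 2 ^ 2 by norm_num, Real.log_pow] at h2
  push_cast at h2
  have := Real.log_two_lt_d9
  rw [abs_le]
  constructor <;> linarith

lemma capacity_sub_half_log_isBigO :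
    (fun n : ℕ => (capacity n).toReal - 1 / 2 * Real.log n) =O[Filter.atTop]
      (fun _ : ℕ => (1 : ℝ)) := by
  refine Asymptotics.IsBigO.of_bound 2 ?_
  filter_upwards [Filter.eventually_ge_atTop 1] with n hn
  simpa using abs_toReal_capacity_sub_half_log_le hn

lemma capacity_isEquivalent_half_log :
    Asymptotics.IsEquivalent Filter.atTop (fun n : ℕ => (capacity n).toReal)
      (fun n : ℕ => 1 / 2 * Real.log n) := by
  refine capacity_sub_half_log_isBigO.trans_isLittleO ?_
  exact ((Real.isLittleO_const_log_atTop (c := 1)).comp_tendsto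
    tendsto_natCast_atTop_atTop).const_mul_right (by norm_num)

theorem mainTheorem3 :
    (∀ n : ℕ, 1 ≤ n →
      -- the supremum defining the capacity is a finite maximum
      (∃ P : ProbabilityMeasure I, mutualInfo P (binomialChannel n) = capacity n) ∧
      capacity n ≠ ∞ ∧
      -- lower bound
      max (Real.log 2)
          (Real.log (Real.pi * n)
            - 1 / 2 * Real.log (2 * Real.pi * Real.exp 1 * ((n : ℝ) / 8 + 1 / 12))
            + 1 / √(Real.pi * ((n : ℝ) + 1 / 4)) * Real.log (1 / (16 * (n : ℝ) ^ 2))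
            - Real.log 4 - 1)
        ≤ (capacity n).toReal ∧
      -- the second lower bound is achieved by the arcsine input
      Real.log (Real.pi * n)
            - 1 / 2 * Real.log (2 * Real.pi * Real.exp 1 * ((n : ℝ) / 8 + 1 / 12))
            + 1 / √(Real.pi * ((n : ℝ) + 1 / 4)) * Real.log (1 / (16 * (n : ℝ) ^ 2))
            - Real.log 4 - 1
        ≤ (mutualInfo arcsineLaw (binomialChannel n)).toReal ∧
      -- upper bound
      (capacity n).toReal ≤
        min (Real.log (3 + (⌊((n : ℝ) - 1) / 2⌋ : ℝ)))
          (Real.log (Real.pi * ((n : ℝ) + 1)) - 1 / 2 * Real.log n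
            + 3 / 2 + 1 / 2 ^ (n + 1) * Real.log n
            + 1 / 2 * Real.log (3 / 2 * (1 + 1 / (n : ℝ))))) ∧
    -- scaling as `(1 / 2) log n`
    (fun n : ℕ => (capacity n).toReal - 1 / 2 * Real.log n) =O[Filter.atTop]
      (fun _ : ℕ => (1 : ℝ)) ∧
    Asymptotics.IsEquivalent Filter.atTop (fun n : ℕ => (capacity n).toReal)
      (fun n : ℕ => 1 / 2 * Real.log n) := by
  refine ⟨fun n hn => ⟨exists_mutualInfo_eq_capacity n, capacity_ne_top n, max_le ?_ ?_, ?_,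
    le_min (toReal_capacity_le_log_floor n) (toReal_capacity_le_of_stirling hn)⟩,
    capacity_sub_half_log_isBigO, capacity_isEquivalent_half_log⟩
  · exact binomialInfo_endpointLaw hn ▸ binomialInfo_le_toReal_capacity n endpointLaw
  · exact (le_binomialInfo_arcsineLaw' hn).trans (binomialInfo_le_toReal_capacity n arcsineLaw)
  · rw [toReal_mutualInfo_binomialChannel]
    exact le_binomialInfo_arcsineLaw' hn
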